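/- Let $N\ge 1$ and $m\ge 1$. Consider $N$ agents with states $x_i[k]\in\mathbb{R}^m$, scalar inputs $u_i[k]$ and scalar outputs $y_i[k]$ satisfying, for $k=0,1,2,\dots$, $$x_i[k+1]=Ax_i[k]+Bu_i[k],\qquad y_i[k]=Cx_i[k],\qquad i=1,\dots,N,$$ where $A\in\mathbb{R}^{m\times m}$ has ones on the first superdiagonal and zeros elsewhere, $B=(0,\dots,0,1)^T\in\mathbb{R}^{m}$, and $C\in\mathbb{R}^{1\times m}$ is a row vector. The communication topology is given by a finite family of digraphs $\mathcal{G}_p$, $p\in\mathcal{S}$, on the nodes $v_1,\dots,v_N$, without self-edges, with a weight $\alpha_p^{ij}>0$ for every edge of $\mathcal{G}_p$ from $v_j$ to $v_i$, and a switching signal $\sigma:\{0,1,2,\dots\}\to\mathcal{S}$. Let $\mathcal{N}_i[\sigma[k]]$ be the set of those $j$ for which $\mathcal{G}_{\sigma[k]}$ has an edge from $v_j$ to $v_i$. Given $b_1,\dots,b_{m-1}\in\mathbb{R}$, put $$K_4=(b_1,\,b_2-b_1,\,\dots,\,b_{m-1}-b_{m-2},\,1-b_{m-1}),\qquad K_5=(b_1,b_2,\dots,b_{m-1},1)$$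 (for $m=1$, $K_4=K_5=(1)$), let $K_6\in\mathbb{R}^{m\times 1}$, and let the agents use the observer-based protocol $$u_i[k]=K_4z_i[k]-\frac{1}{1+\sum_{j\in\mathcal{N}_i[\sigma[k]]}\alpha^{ij}_{\sigma[k]}}\sum_{j\in\mathcal{N}_i[\sigma[k]]}\alpha^{ij}_{\sigma[k]}K_5(z_i[k]-z_j[k]),$$ $$z_i[k+1]=(A+K_6C)z_i[k]+Bu_i[k]-K_6y_i[k].$$ Suppose that 1. the topology is uniformly jointly quasi-strongly connected in the discrete-time sense: there is an integer $M>0$ such that for every $k>0$ the union of the digraphs $\mathcal{G}_{\sigma[k]},\mathcal{G}_{\sigma[k+1]},\dots,\mathcal{G}_{\sigma[k+M]}$ has a node from which there are directed paths to all other nodes; 2. all eigenvalues of $A+K_6C$ lie in the open unit disc; 3. all complex roots of $s^{m-1}+b_{m-1}s^{m-2}+\dots+b_2s+b_1$ lie in the open unit disc. Then the agents reach a consensus: for all initial states $x_i[0]$ and $z_i[0]$ there is a vector $x^*\in\mathbb{R}^m$ such that $\lim_{k\to\infty}x_i[k]=x^*$ for every $i=1,\dots,N$. -/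

import Mathlib

open Filter Topology Matrix

noncomputable section

namespace HighOrderConsensus

/-! ### Switching communication topology -/

/-- A finite family (indexed by `S`) of digraphs without self-edges on the agents `Fin N`, with a
positive weight on every edge. `(graph p).Adj j i` says that the edge `e_ij` from `v_j` to `v_i` is
present in the graph with index `p`, i.e. agent `i` receives information from agent `j`; its weight
is `weight p i j`. Weights of absent edges play no role. -/
structure SwitchingTopology (N : ℕ) (S : Type*) where
  graph : S → Digraph (Fin N)
  loopless : ∀ p i, ¬ (graph p).Adj i i
  weight : S → Fin N → Fin N → ℝ
  weight_pos : ∀ p i j, (graph p).Adj j i → 0 < weight p i j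

/-- `c` is a center (root): there is a directed path from `c` to every other node. (A directed walk
always contains a path on distinct nodes, so reachability is stated by `ReflTransGen`.) -/
def IsCenter {V : Type*} (G : Digraph V) (c : V) : Prop :=
  ∀ v, v ≠ c → Relation.ReflTransGen G.Adj c v

/-- A digraph is quasi-strongly connected if it has at least one center. -/
def QuasiStronglyConnected {V : Type*} (G : Digraph V) : Prop :=
  ∃ c, IsCenter G c

/-- The union of the digraphs `G[k], G[k+1], …, G[k+M]` (the same nodes, all the edges). -/
def unionGraph {V : Type*} (G : ℕ → Digraph V) (k M : ℕ) : Digraph V where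
  Adj a b := ∃ l ∈ Finset.Icc k (k + M), (G l).Adj a b

/-- Uniform joint quasi-strong connectivity in the discrete-time sense. -/
def UniformlyJointlyQSC {V : Type*} (G : ℕ → Digraph V) : Prop :=
  ∃ M : ℕ, 0 < M ∧ ∀ k : ℕ, 0 < k → QuasiStronglyConnected (unionGraph G k M)

open Classical in
/-- The neighbor set `N_i` of agent `i` in the graph with index `p`. -/
def SwitchingTopology.neighbors {N : ℕ} {S : Type*} (T : SwitchingTopology N S) (p : S) (i : Fin N) :
    Finset (Fin N) :=
  Finset.univ.filter fun j => (T.graph p).Adj j i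

/-! ### Agents and protocol: the order is `m = n + 1`, the parameters are
`(b_1, …, b_{m-1}) = (b 0, …, b (n-1))` -/

/-- The shift matrix `A` (ones on the superdiagonal, zeros elsewhere). -/
def sysA (n : ℕ) : Matrix (Fin (n + 1)) (Fin (n + 1)) ℝ :=
  Matrix.of fun i j => if (j : ℕ) = (i : ℕ) + 1 then 1 else 0

/-- `B = (0, …, 0, 1)ᵀ`. -/
def sysB (n : ℕ) : Fin (n + 1) → ℝ := Pi.single (Fin.last n) 1

/-- `K₅ = (b_1, b_2, …, b_{m-1}, 1)`. -/
def gainK5 {n : ℕ} (b : Fin n → ℝ) : Fin (n + 1) → ℝ :=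
  Fin.snoc (α := fun _ => ℝ) b 1

/-- `K₄ = (b_1, b_2 - b_1, …, b_{m-1} - b_{m-2}, 1 - b_{m-1})`: the difference of
`(b_1, b_2, …, b_{m-1}, 1)` and `(0, b_1, …, b_{m-2}, b_{m-1})`. -/
def gainK4 {n : ℕ} (b : Fin n → ℝ) : Fin (n + 1) → ℝ := fun j =>
  Fin.snoc (α := fun _ => ℝ) b 1 j - Fin.cons (α := fun _ => ℝ) 0 b j

/-- `A + K₆ C`, with `K₆` a column vector and `C` a row vector. -/
def observerMatrix {n : ℕ} (K6 C : Fin (n + 1) → ℝ) : Matrix (Fin (n + 1)) (Fin (n + 1)) ℝ :=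
  sysA n + Matrix.vecMulVec K6 C

/-- All (complex) eigenvalues of a real square matrix lie in the open unit disc. -/
def IsSchur {ι : Type*} [Fintype ι] [DecidableEq ι] (P : Matrix ι ι ℝ) : Prop :=
  ∀ μ ∈ spectrum ℂ (P.map (algebraMap ℝ ℂ)), ‖μ‖ < 1

/-- All complex roots of `s^{m-1} + b_{m-1} s^{m-2} + ⋯ + b_2 s + b_1` lie in the open unit disc. -/
def CharRootsInUnitDisc {n : ℕ} (b : Fin n → ℝ) : Prop :=
  ∀ s : ℂ, s ^ n + ∑ j : Fin n, (b j : ℂ) * s ^ (j : ℕ) = 0 → ‖s‖ < 1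

/-- The agents `x_i[k+1] = A x_i[k] + B u_i[k]`, `y_i[k] = C x_i[k]` (with arbitrary initial states)
run under the observer-based protocol with observer states `z_i`. -/
structure IsTrajectory {N n : ℕ} {S : Type*} (T : SwitchingTopology N S) (σ : ℕ → S)
    (b : Fin n → ℝ) (C K6 : Fin (n + 1) → ℝ)
    (x z : Fin N → ℕ → Fin (n + 1) → ℝ) (u y : Fin N → ℕ → ℝ) : Prop where
  state : ∀ i k, x i (k + 1) = sysA n *ᵥ x i k + u i k • sysB n
  output : ∀ i k, y i k = C ⬝ᵥ x i k
  input : ∀ i k, u i k = gainK4 b ⬝ᵥ z i k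
    - (1 / (1 + ∑ j ∈ T.neighbors (σ k) i, T.weight (σ k) i j)) *
      ∑ j ∈ T.neighbors (σ k) i, T.weight (σ k) i j * (gainK5 b ⬝ᵥ (z i k - z j k))
  observer : ∀ i k, z i (k + 1) = observerMatrix K6 C *ᵥ z i k + u i k • sysB n - y i k • K6

/-- The agents' states all converge to one common vector. -/
def ReachesConsensus {N n : ℕ} (x : Fin N → ℕ → Fin (n + 1) → ℝ) : Prop :=
  ∃ xstar : Fin (n + 1) → ℝ, ∀ i, Tendsto (x i) atTop (𝓝 xstar)

end HighOrderConsensus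

end

namespace HighOrderConsensus

/-! ### Summability of perturbed linear recursions -/

/-! Put `r_i = K₅ z_i` and `e_i = z_i - x_i`. Since `K₅ B = 1` and `K₄ = K₅ - K₅ A`, the protocol
turns `r` into a first-order averaging process: `r[k+1] = P[k] r[k] + ε[k]`, with `P[k]`
row-stochastic with positive diagonal and `ε_i = (C e_i)(K₅ K₆)`. The error obeys `e_i[k+1] = (A +
K₆ C) e_i[k]`, so it is summable, and so is `ε`.

Joint connectivity makes any two rows of a long enough product of the `P[k]` share a column with
entries at least some uniform `δ > 0`. Such a product shrinks the spread of `r` by the factor `1 -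
δ`, so the spread is summable, `r` has bounded variation, and all `r_i` tend to one `c`
(`exists_consensus_of_summable_perturbation`).

Eliminating `u_i` gives `z_i[k+1] = (A - B K₅ A) z_i[k] + B r_i[k+1] + (error term)`. The
eigenvalues of `A - B K₅ A` are among `0` and the roots in hypothesis 3 (`isSchur_companionMatrix`),
so `z_i` converges to the only solution of `v = (A - B K₅ A) v + c B`, the same for every agent
(`IsSchur.exists_tendsto`). As `e_i → 0`, `x_i` has the same limit.

Summability, rather than a decay rate, is the notion carried through all the estimates. -/

lemma summable_of_add_le {a c : ℕ → ℝ} {q : ℝ} {p : ℕ} (ha : ∀ k, 0 ≤ a k) (hc0 : ∀ k, 0 ≤ c k)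
    (hq : q < 1) (hc : Summable c) (h : ∀ k, a (k + p) ≤ q * a k + c k) : Summable a := by
  refine summable_of_sum_range_le (c := (∑ k ∈ Finset.range p, a k + ∑' k, c k) / (1 - q)) ha
    fun n => ?_
  rw [le_div_iff₀ (by linarith)]
  have h1 : ∑ k ∈ Finset.range n, a k ≤ ∑ k ∈ Finset.range (p + n), a k :=
    Finset.sum_le_sum_of_subset_of_nonneg (Finset.range_mono (by omega)) fun k _ _ => ha k
  rw [Finset.sum_range_add] at h1
  have h2 : ∑ k ∈ Finset.range n, a (p + k) ≤
      q * ∑ k ∈ Finset.range n, a k + ∑ k ∈ Finset.range n, c k := by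
    rw [Finset.mul_sum, ← Finset.sum_add_distrib]
    exact Finset.sum_le_sum fun k _ => add_comm k p ▸ h k
  have h3 : ∑ k ∈ Finset.range n, c k ≤ ∑' k, c k := hc.sum_le_tsum _ fun k _ => hc0 k
  linarith

variable {ι : Type*} [Fintype ι] [DecidableEq ι]

/-- The transition matrix `P (s + t - 1) * ⋯ * P (s + 1) * P s`. -/
def transition (P : ℕ → Matrix ι ι ℝ) (s : ℕ) : ℕ → Matrix ι ι ℝ
  | 0 => 1
  | t + 1 => P (s + t) * transition P s t

lemma transition_const (P : Matrix ι ι ℝ) (s t : ℕ) : transition (fun _ => P) s t = P ^ t := by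
  induction t with
  | zero => rfl
  | succ t ih => rw [transition, ih, pow_succ']

lemma transition_add (P : ℕ → Matrix ι ι ℝ) (s t v : ℕ) :
    transition P s (t + v) = transition P (s + t) v * transition P s t := by
  induction v with
  | zero => simp [transition]
  | succ v ih => rw [← add_assoc, transition, ih, transition, Matrix.mul_assoc, add_assoc]

/-- Contraction is only available over blocks of `p` steps; this shows that the inputs accumulated
within a block stay summable, so that `summable_of_add_le` applies. -/
lemma exists_summable_norm_sub_transition_le {P : ℕ → Matrix ι ι ℝ} {K : ℝ} (hK : 0 ≤ K)
    (hP : ∀ k v, ‖P k *ᵥ v‖ ≤ K * ‖v‖) {d h : ℕ → ι → ℝ}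
    (hd : ∀ k, d (k + 1) = P k *ᵥ d k + h k) (hh : Summable fun k => ‖h k‖) (p : ℕ) :
    ∃ c : ℕ → ℝ, (∀ k, 0 ≤ c k) ∧ Summable c ∧
      ∀ k, ‖d (k + p) - transition P k p *ᵥ d k‖ ≤ c k := by
  induction p with
  | zero => exact ⟨0, fun _ => le_rfl, summable_zero, fun k => by simp [transition]⟩
  | succ p ih =>
    obtain ⟨c, hc0, hc, hle⟩ := ih
    refine ⟨fun k => K * c k + ‖h (k + p)‖, fun k => ?_, ?_, fun k => ?_⟩
    · have := mul_nonneg hK (hc0 k)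
      positivity
    · exact (hc.mul_left K).add ((summable_nat_add_iff p).2 hh)
    · have : d (k + (p + 1)) - transition P k (p + 1) *ᵥ d k =
          P (k + p) *ᵥ (d (k + p) - transition P k p *ᵥ d k) + h (k + p) := by
        rw [← add_assoc, hd, transition, ← mulVec_mulVec, mulVec_sub]
        abel
      rw [this]
      refine (norm_add_le _ _).trans (add_le_add_left ((hP _ _).trans ?_) _)
      exact mul_le_mul_of_nonneg_left (hle k) hK

/-! ### Schur matrices -/

section LinftyNorm

attribute [local instance] Matrix.linftyOpNormedRing Matrix.linftyOpNormedAlgebra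

lemma norm_mulVec_le_linftyOpNorm (P : Matrix ι ι ℝ) :
    ∃ K : ℝ, 0 ≤ K ∧ ∀ v, ‖P *ᵥ v‖ ≤ K * ‖v‖ :=
  ⟨‖P‖, norm_nonneg _, fun v => linfty_opNorm_mulVec P v⟩

/-- By Gelfand's formula some power of the complexified matrix has norm below 1. The operator norm
is the one induced by the sup norm, for which real vectors embed isometrically into complex ones. -/
lemma IsSchur.exists_pow_contracting [Nonempty ι] {P : Matrix ι ι ℝ} (hP : IsSchur P) :
    ∃ (p : ℕ) (q : ℝ), q < 1 ∧ ∀ v, ‖P ^ p *ᵥ v‖ ≤ q * ‖v‖ := by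
  set Q : Matrix ι ι ℂ := P.map (algebraMap ℝ ℂ) with hQ
  have hrad : spectralRadius ℂ Q < (1 : NNReal) :=
    spectrum.spectralRadius_lt_of_forall_lt Q fun μ hμ => by
      have := hP μ hμ
      rwa [← NNReal.coe_lt_coe, coe_nnnorm]
  have hev := (spectrum.pow_nnnorm_pow_one_div_tendsto_nhds_spectralRadius Q).eventually_lt_const
    hrad
  obtain ⟨p, hp, hp0⟩ := (hev.and (eventually_gt_atTop 0)).exists
  have hlt : ‖Q ^ p‖₊ < 1 := by
    have hpos : (0 : ℝ) < 1 / p := by positivity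
    by_contra hcon
    have hge : (1 : ENNReal) ≤ (‖Q ^ p‖₊ : ENNReal) := by exact_mod_cast not_lt.1 hcon
    have := ENNReal.rpow_le_rpow hge hpos.le
    rw [ENNReal.one_rpow] at this
    exact absurd hp (not_lt.2 (by simpa using this))
  refine ⟨p, ‖Q ^ p‖, by exact_mod_cast hlt, fun v => ?_⟩
  have hcast : ∀ w : ι → ℝ, ‖fun i => (algebraMap ℝ ℂ) (w i)‖ = ‖w‖ := fun w => by
    simp [Pi.norm_def]
  have hmap : (fun i => (algebraMap ℝ ℂ) ((P ^ p *ᵥ v) i)) =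
      Q ^ p *ᵥ fun i => (algebraMap ℝ ℂ) (v i) := by
    ext i
    rw [RingHom.map_mulVec, hQ, ← RingHom.mapMatrix_apply, map_pow]
    rfl
  rw [← hcast, ← hcast v, hmap]
  exact linfty_opNorm_mulVec _ _

end LinftyNorm

lemma IsSchur.summable_norm [Nonempty ι] {P : Matrix ι ι ℝ} (hP : IsSchur P) {d h : ℕ → ι → ℝ}
    (hd : ∀ k, d (k + 1) = P *ᵥ d k + h k) (hh : Summable fun k => ‖h k‖) :
    Summable fun k => ‖d k‖ := by
  obtain ⟨p, q, hq, hpq⟩ := hP.exists_pow_contracting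
  obtain ⟨K, hK, hPK⟩ := norm_mulVec_le_linftyOpNorm P
  obtain ⟨c, hc0, hc, hle⟩ := exists_summable_norm_sub_transition_le (P := fun _ => P) hK
    (fun _ => hPK) hd hh p
  refine summable_of_add_le (p := p) (fun k => norm_nonneg _) hc0 hq hc fun k => ?_
  have h1 := hle k
  rw [transition_const] at h1
  have h2 := norm_le_norm_add_norm_sub (P ^ p *ᵥ d k) (d (k + p))
  have h3 := hpq (d k)
  rw [norm_sub_rev] at h1
  linarith

lemma IsSchur.eq_zero_of_mulVec_eq_self [Nonempty ι] {P : Matrix ι ι ℝ} (hP : IsSchur P)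
    {v : ι → ℝ} (hv : P *ᵥ v = v) : v = 0 := by
  have := hP.summable_norm (d := fun _ => v) (h := fun _ => 0) (fun k => by simp [hv]) (by simp)
  simpa [summable_const_iff] using this

/-- A Schur system driven by an input of bounded variation converges to a fixed point. -/
lemma IsSchur.exists_tendsto [Nonempty ι] {P : Matrix ι ι ℝ} (hP : IsSchur P) {d h : ℕ → ι → ℝ}
    {g : ι → ℝ} (hd : ∀ k, d (k + 1) = P *ᵥ d k + h k)
    (hh : Summable fun k => ‖h (k + 1) - h k‖) (hg : Tendsto h atTop (𝓝 g)) :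
    ∃ v, Tendsto d atTop (𝓝 v) ∧ v = P *ᵥ v + g := by
  -- The increments of `d` follow the same recursion, driven by the increments of `h`.
  have hs := hP.summable_norm (d := fun k => d (k + 1) - d k) (h := fun k => h (k + 1) - h k)
    (fun k => by rw [hd (k + 1), hd k, mulVec_sub]; abel) hh
  have hcau : CauchySeq d := cauchySeq_of_summable_dist <| by
    simpa only [dist_eq_norm, norm_sub_rev] using hs
  obtain ⟨v, hv⟩ := cauchySeq_tendsto_of_complete hcau
  refine ⟨v, hv, tendsto_nhds_unique ((tendsto_add_atTop_iff_nat 1).2 hv) ?_⟩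
  simp only [hd]
  have hcont : Continuous fun w : ι → ℝ => P *ᵥ w := by fun_prop
  exact ((hcont.tendsto v).comp hv).add hg

/-! ### Row-stochastic matrices -/

lemma norm_mulVec_le_of_mem_rowStochastic {P : Matrix ι ι ℝ} (hP : P ∈ rowStochastic ℝ ι)
    (v : ι → ℝ) : ‖P *ᵥ v‖ ≤ ‖v‖ := by
  refine (pi_norm_le_iff_of_nonneg (norm_nonneg _)).2 fun i => ?_
  calc ‖∑ j, P i j * v j‖ ≤ ∑ j, P i j * ‖v‖ := norm_sum_le_of_le _ fun j _ => by
        rw [norm_mul, Real.norm_of_nonneg (hP.1 i j)]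
        exact mul_le_mul_of_nonneg_left (norm_le_pi_norm v j) (hP.1 i j)
    _ = ‖v‖ := by rw [← Finset.sum_mul, sum_row_of_mem_rowStochastic hP, one_mul]

lemma mul_le_mul_apply_of_mem_rowStochastic {P Q : Matrix ι ι ℝ} (hP : P ∈ rowStochastic ℝ ι)
    (hQ : Q ∈ rowStochastic ℝ ι) (i m j : ι) : P i m * Q m j ≤ (P * Q) i j := by
  rw [mul_apply]
  exact Finset.single_le_sum (f := fun m => P i m * Q m j)
    (fun m _ => mul_nonneg (hP.1 i m) (hQ.1 m j)) (Finset.mem_univ m)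

lemma exists_pos_of_mul_apply_pos {P Q : Matrix ι ι ℝ} (hP : P ∈ rowStochastic ℝ ι)
    (hQ : Q ∈ rowStochastic ℝ ι) {i j : ι} (h : 0 < (P * Q) i j) :
    ∃ m, 0 < P i m ∧ 0 < Q m j := by
  rw [mul_apply] at h
  obtain ⟨m, -, hm⟩ := Finset.exists_lt_of_sum_lt (f := fun _ => (0 : ℝ)) (by simpa using h)
  refine ⟨m, (hP.1 i m).lt_of_ne fun h0 => ?_, (hQ.1 m j).lt_of_ne fun h0 => ?_⟩ <;>
  simp [← h0] at hm

lemma transition_mem_rowStochastic {P : ℕ → Matrix ι ι ℝ} (hP : ∀ k, P k ∈ rowStochastic ℝ ι)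
    (s t : ℕ) : transition P s t ∈ rowStochastic ℝ ι := by
  induction t with
  | zero => exact one_mem _
  | succ t ih => exact mul_mem (hP _) ih

lemma transition_apply_self_pos {P : ℕ → Matrix ι ι ℝ} (hP : ∀ k, P k ∈ rowStochastic ℝ ι)
    (hdiag : ∀ k i, 0 < P k i i) (s t : ℕ) (i : ι) : 0 < transition P s t i i := by
  induction t with
  | zero => simp [transition]
  | succ t ih =>
    exact (mul_pos (hdiag _ i) ih).trans_le (mul_le_mul_apply_of_mem_rowStochastic (hP _)
      (transition_mem_rowStochastic hP s t) i i i)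

lemma pow_le_transition_apply {P : ℕ → Matrix ι ι ℝ} (hP : ∀ k, P k ∈ rowStochastic ℝ ι)
    {η : ℝ} (hη : 0 < η) (hle : ∀ k i j, 0 < P k i j → η ≤ P k i j) (s t : ℕ) (i j : ι)
    (h : 0 < transition P s t i j) : η ^ t ≤ transition P s t i j := by
  induction t generalizing i j with
  | zero =>
    rcases eq_or_ne i j with rfl | hij
    · simp [transition]
    · simp [transition, hij] at h
  | succ t ih =>
    have ht := transition_mem_rowStochastic hP s t
    obtain ⟨m, h1, h2⟩ := exists_pos_of_mul_apply_pos (hP _) ht h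
    refine le_trans ?_ (mul_le_mul_apply_of_mem_rowStochastic (hP _) ht i m j)
    rw [pow_succ']
    exact mul_le_mul (hle _ _ _ h1) (ih m j h2) (by positivity) h1.le

/-- Positive diagonals let an entry positive at one time survive multiplication by the factors
before and after it. The `M + 1` factors cover the times `s, …, s + M`. -/
lemma transition_apply_pos_of_mem_Icc {P : ℕ → Matrix ι ι ℝ} (hP : ∀ k, P k ∈ rowStochastic ℝ ι)
    (hdiag : ∀ k i, 0 < P k i i) {s M l : ℕ} (hl : l ∈ Finset.Icc s (s + M)) {i j : ι}
    (h : 0 < P l i j) : 0 < transition P s (M + 1) i j := by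
  obtain ⟨h1, h2⟩ := Finset.mem_Icc.1 hl
  obtain ⟨t, rfl⟩ := Nat.exists_eq_add_of_le h1
  obtain ⟨w, hw⟩ := Nat.exists_eq_add_of_le (show t ≤ M by omega)
  have hM : M + 1 = t + 1 + w := by omega
  rw [hM, transition_add]
  have hstep : 0 < transition P s (t + 1) i j :=
    (mul_pos h (transition_apply_self_pos hP hdiag s t j)).trans_le
      (mul_le_mul_apply_of_mem_rowStochastic (hP _) (transition_mem_rowStochastic hP s t) i j j)
  exact (mul_pos (transition_apply_self_pos hP hdiag _ w i) hstep).trans_le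
    (mul_le_mul_apply_of_mem_rowStochastic (transition_mem_rowStochastic hP _ w)
      (transition_mem_rowStochastic hP s _) i i j)

/-! ### Scrambling products -/

lemma exists_adj_of_reflTransGen {V : Type*} {r : V → V → Prop} {a b : V} {A : Set V}
    (h : Relation.ReflTransGen r a b) (ha : a ∉ A) (hb : b ∈ A) :
    ∃ x y, x ∉ A ∧ y ∈ A ∧ r x y := by
  induction h with
  | refl => exact absurd hb ha
  | @tail y z _ hyz ih =>
    by_cases hy : y ∈ A
    · exact ih hy
    · exact ⟨y, z, hy, hb, hyz⟩

/-- The support of a row of a matrix. -/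
noncomputable def rowSupport (Q : Matrix ι ι ℝ) (i : ι) : Finset ι :=
  Finset.univ.filter fun l => 0 < Q i l

omit [DecidableEq ι] in
@[simp]
lemma mem_rowSupport {Q : Matrix ι ι ℝ} {i l : ι} : l ∈ rowSupport Q i ↔ 0 < Q i l := by
  simp [rowSupport]

lemma rowSupport_subset_mul {Q R : Matrix ι ι ℝ} (hQ : Q ∈ rowStochastic ℝ ι)
    (hR : R ∈ rowStochastic ℝ ι) (hdiag : ∀ i, 0 < R i i) (i : ι) :
    rowSupport Q i ⊆ rowSupport (Q * R) i := fun l hl => by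
  rw [mem_rowSupport] at hl ⊢
  exact (mul_pos hl (hdiag l)).trans_le (mul_le_mul_apply_of_mem_rowStochastic hQ hR i l l)

/-- A path from the center `c`, outside the support of row `i`, to `i`, inside it, enters the
support along some edge; right multiplication by `R` adds the tail of that edge. -/
lemma rowSupport_card_lt_mul {V : Digraph ι} {Q R : Matrix ι ι ℝ} (hQ : Q ∈ rowStochastic ℝ ι)
    (hR : R ∈ rowStochastic ℝ ι) (hdiag : ∀ i, 0 < R i i)
    (hadj : ∀ i j, V.Adj j i → 0 < R i j) {c : ι} (hc : IsCenter V c) {i : ι} (hi : 0 < Q i i)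
    (hci : c ∉ rowSupport Q i) : (rowSupport Q i).card < (rowSupport (Q * R) i).card := by
  have hne : i ≠ c := by
    rintro rfl
    exact hci (mem_rowSupport.2 hi)
  obtain ⟨x, y, hx, hy, hxy⟩ := exists_adj_of_reflTransGen (A := {l | l ∈ rowSupport Q i})
    (hc i hne) hci (mem_rowSupport.2 hi)
  refine Finset.card_lt_card (Finset.ssubset_iff_of_subset
    (rowSupport_subset_mul hQ hR hdiag i) |>.2 ⟨x, ?_, hx⟩)
  rw [mem_rowSupport]
  exact (mul_pos (mem_rowSupport.1 hy) (hadj y x hxy)).trans_le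
    (mul_le_mul_apply_of_mem_rowStochastic hQ hR i y x)

/-- For each window, either its center lies in both supports, giving a common column, or one of the
supports misses it and grows strictly. -/
lemma transition_common_support_or_card {P : ℕ → Matrix ι ι ℝ}
    (hP : ∀ k, P k ∈ rowStochastic ℝ ι) (hdiag : ∀ k i, 0 < P k i i) {G : ℕ → Digraph ι}
    (hadj : ∀ k i j, (G k).Adj j i → 0 < P k i j) {M : ℕ}
    (hG : ∀ k, 0 < k → QuasiStronglyConnected (unionGraph G k M)) (i j : ι) (w s : ℕ)
    (hs : 0 < s) :
    (∃ l, 0 < transition P s (w * (M + 1)) i l ∧ 0 < transition P s (w * (M + 1)) j l) ∨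
      w ≤ (rowSupport (transition P s (w * (M + 1))) i).card +
        (rowSupport (transition P s (w * (M + 1))) j).card := by
  induction w generalizing s with
  | zero => simp
  | succ w ih =>
    -- The window split off is the earliest in time, hence the right factor, which is the side that
    -- enlarges row supports.
    rw [add_mul, one_mul, add_comm (w * (M + 1)), transition_add]
    have hQ := transition_mem_rowStochastic hP (s + (M + 1)) (w * (M + 1))
    have hR := transition_mem_rowStochastic hP s (M + 1)
    have hRd := transition_apply_self_pos hP hdiag s (M + 1)
    have hQd := transition_apply_self_pos hP hdiag (s + (M + 1)) (w * (M + 1))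
    have hRadj : ∀ i j, (unionGraph G s M).Adj j i → 0 < transition P s (M + 1) i j := by
      rintro i j ⟨l, hl, h⟩
      exact transition_apply_pos_of_mem_Icc hP hdiag hl (hadj l i j h)
    have hmono := rowSupport_subset_mul hQ hR hRd
    have hcommon : (∃ l, l ∈ rowSupport (transition P (s + (M + 1)) (w * (M + 1))) i ∧
        l ∈ rowSupport (transition P (s + (M + 1)) (w * (M + 1))) j) →
        ∃ l, 0 < (transition P (s + (M + 1)) (w * (M + 1)) * transition P s (M + 1)) i l ∧
          0 < (transition P (s + (M + 1)) (w * (M + 1)) * transition P s (M + 1)) j l := by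
      rintro ⟨l, h1, h2⟩
      exact ⟨l, mem_rowSupport.1 (hmono i h1), mem_rowSupport.1 (hmono j h2)⟩
    rcases ih (s + (M + 1)) (by omega) with ⟨l, h1, h2⟩ | hcard
    · exact Or.inl (hcommon ⟨l, mem_rowSupport.2 h1, mem_rowSupport.2 h2⟩)
    obtain ⟨c, hc⟩ := hG s hs
    have hi := Finset.card_le_card (hmono i)
    have hj := Finset.card_le_card (hmono j)
    by_cases hci : c ∈ rowSupport (transition P (s + (M + 1)) (w * (M + 1))) i
    · by_cases hcj : c ∈ rowSupport (transition P (s + (M + 1)) (w * (M + 1))) j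
      · exact Or.inl (hcommon ⟨c, hci, hcj⟩)
      · have := rowSupport_card_lt_mul hQ hR hRd hRadj hc (hQd j) hcj
        exact Or.inr (by omega)
    · have := rowSupport_card_lt_mul hQ hR hRd hRadj hc (hQd i) hci
      exact Or.inr (by omega)

lemma exists_common_transition_ge {P : ℕ → Matrix ι ι ℝ}
    (hP : ∀ k, P k ∈ rowStochastic ℝ ι) (hdiag : ∀ k i, 0 < P k i i) {η : ℝ} (hη : 0 < η)
    (hle : ∀ k i j, 0 < P k i j → η ≤ P k i j) {G : ℕ → Digraph ι}
    (hadj : ∀ k i j, (G k).Adj j i → 0 < P k i j) (hG : UniformlyJointlyQSC G) :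
    ∃ (t : ℕ) (δ : ℝ), 0 < δ ∧ ∀ s, 0 < s → ∀ i j, ∃ l,
      δ ≤ transition P s t i l ∧ δ ≤ transition P s t j l := by
  obtain ⟨M, -, hM⟩ := hG
  -- With this many windows the two support sizes add up to more than `card ι`, so the supports must
  -- meet.
  set w := Fintype.card ι + 1
  refine ⟨w * (M + 1), η ^ (w * (M + 1)), by positivity, fun s hs i j => ?_⟩
  have key : ∃ l, 0 < transition P s (w * (M + 1)) i l ∧
      0 < transition P s (w * (M + 1)) j l := by
    rcases transition_common_support_or_card hP hdiag hadj hM i j w s hs with h | h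
    · exact h
    · obtain ⟨l, hl⟩ := Finset.inter_nonempty_of_card_lt_card_add_card
        (Finset.subset_univ (rowSupport (transition P s (w * (M + 1))) i))
        (Finset.subset_univ (rowSupport (transition P s (w * (M + 1))) j))
        (by rw [Finset.card_univ]; omega)
      simp only [Finset.mem_inter, mem_rowSupport] at hl
      exact ⟨l, hl⟩
  obtain ⟨l, h1, h2⟩ := key
  exact ⟨l, pow_le_transition_apply hP hη hle _ _ _ _ h1,
    pow_le_transition_apply hP hη hle _ _ _ _ h2⟩

/-! ### Contraction of the spread and consensus -/

/-- The largest difference of two coordinates. -/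
noncomputable def spread (v : ι → ℝ) : ℝ := ‖fun p : ι × ι => v p.1 - v p.2‖

omit [DecidableEq ι] in
lemma abs_sub_le_spread (v : ι → ℝ) (i j : ι) : |v i - v j| ≤ spread v :=
  norm_le_pi_norm (fun p : ι × ι => v p.1 - v p.2) (i, j)

omit [DecidableEq ι] in
lemma spread_nonneg (v : ι → ℝ) : 0 ≤ spread v := norm_nonneg _

omit [DecidableEq ι] in
lemma spread_le {v : ι → ℝ} {D : ℝ} (hD : 0 ≤ D) (h : ∀ i j, v i - v j ≤ D) : spread v ≤ D :=
  (pi_norm_le_iff_of_nonneg hD).2 fun p => abs_le.2 ⟨by linarith [h p.2 p.1], h p.1 p.2⟩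

omit [DecidableEq ι] in
lemma spread_le_add (v w : ι → ℝ) : spread v ≤ spread w + 2 * ‖v - w‖ := by
  refine spread_le (by have := spread_nonneg w; positivity) fun i j => ?_
  have h1 := abs_le.1 (norm_le_pi_norm (v - w) i)
  have h2 := abs_le.1 (norm_le_pi_norm (v - w) j)
  have h3 := (abs_le.1 (abs_sub_le_spread w i j)).2
  simp only [Pi.sub_apply] at h1 h2
  linarith [h1.2, h2.1]

lemma sum_mul_le_of_mem_rowStochastic {Q : Matrix ι ι ℝ} (hQ : Q ∈ rowStochastic ℝ ι) {δ c : ℝ}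
    {i l : ι} (hl : δ ≤ Q i l) {v : ι → ℝ} (hv : ∀ m, v m ≤ c) :
    (Q *ᵥ v) i ≤ δ * v l + (1 - δ) * c := by
  have h1 : (Q *ᵥ v) i - c = ∑ m, Q i m * (v m - c) := by
    simp only [mul_sub, Finset.sum_sub_distrib, ← Finset.sum_mul,
      sum_row_of_mem_rowStochastic hQ, one_mul]
    rfl
  have h2 : ∑ m, Q i m * (v m - c) ≤ Q i l * (v l - c) := by
    rw [← Finset.add_sum_erase _ _ (Finset.mem_univ l)]
    have := Finset.sum_nonpos (s := Finset.univ.erase l) (f := fun m => Q i m * (v m - c))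
      fun m _ => mul_nonpos_of_nonneg_of_nonpos (hQ.1 i m) (by linarith [hv m])
    linarith
  nlinarith [mul_nonneg (sub_nonneg.2 hl) (sub_nonneg.2 (hv l))]

/-- Rows `i` and `j` both put weight `δ` on the same `v l`, which cancels in the difference; the
remaining weight `1 - δ` contributes at most `max v - min v`. -/
lemma spread_mulVec_le {Q : Matrix ι ι ℝ} (hQ : Q ∈ rowStochastic ℝ ι) {δ : ℝ}
    (hδ : ∀ i j, ∃ l, δ ≤ Q i l ∧ δ ≤ Q j l) (v : ι → ℝ) :
    spread (Q *ᵥ v) ≤ (1 - δ) * spread v := by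
  rcases isEmpty_or_nonempty ι with hι | hι
  · simp [spread, Pi.norm_def]
  obtain ⟨a, ha⟩ := Finite.exists_max v
  obtain ⟨b, hb⟩ := Finite.exists_min v
  have h1 : 0 ≤ 1 - δ := by
    obtain ⟨l, hl, -⟩ := hδ a a
    linarith [le_one_of_mem_rowStochastic hQ (i := a) (j := l)]
  refine spread_le (mul_nonneg h1 (spread_nonneg v)) fun i j => ?_
  obtain ⟨l, hil, hjl⟩ := hδ i j
  have hi := sum_mul_le_of_mem_rowStochastic hQ hil ha
  have hj := sum_mul_le_of_mem_rowStochastic hQ hjl (v := -v) (c := -v b)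
    fun m => neg_le_neg (hb m)
  rw [mulVec_neg, Pi.neg_apply, Pi.neg_apply] at hj
  have := mul_le_mul_of_nonneg_left (le_of_abs_le (abs_sub_le_spread v a b)) h1
  linarith

/-- Perturbed averaging with jointly connected switching topology reaches consensus, and the
trajectory has bounded variation. -/
theorem exists_consensus_of_summable_perturbation {P : ℕ → Matrix ι ι ℝ}
    (hP : ∀ k, P k ∈ rowStochastic ℝ ι) (hdiag : ∀ k i, 0 < P k i i) {η : ℝ} (hη : 0 < η)
    (hle : ∀ k i j, 0 < P k i j → η ≤ P k i j) {G : ℕ → Digraph ι}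
    (hadj : ∀ k i j, (G k).Adj j i → 0 < P k i j) (hG : UniformlyJointlyQSC G)
    {r ε : ℕ → ι → ℝ} (hr : ∀ k, r (k + 1) = P k *ᵥ r k + ε k)
    (hε : Summable fun k => ‖ε k‖) :
    (Summable fun k => ‖r (k + 1) - r k‖) ∧
      ∃ c, ∀ i, Tendsto (fun k => r k i) atTop (𝓝 c) := by
  obtain ⟨t, δ, hδ, hscr⟩ := exists_common_transition_ge hP hdiag hη hle hadj hG
  obtain ⟨c, hc0, hc, hrc⟩ := exists_summable_norm_sub_transition_le zero_le_one
    (fun k v => by rw [one_mul]; exact norm_mulVec_le_of_mem_rowStochastic (hP k) v) hr hε t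
  have hD : Summable fun k => spread (r k) := by
    -- Connectivity is assumed only for windows starting at positive times.
    rw [← summable_nat_add_iff 1]
    refine summable_of_add_le (p := t) (q := 1 - δ) (c := fun k => 2 * c (k + 1))
      (fun k => spread_nonneg _) (fun k => by have := hc0 (k + 1); positivity) (by linarith)
      (((summable_nat_add_iff 1).2 hc).mul_left 2) fun k => ?_
    have h1 := spread_le_add (r (k + 1 + t)) (transition P (k + 1) t *ᵥ r (k + 1))
    have h2 := spread_mulVec_le (transition_mem_rowStochastic hP (k + 1) t)
      (hscr (k + 1) k.succ_pos) (r (k + 1))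
    have h3 := hrc (k + 1)
    rw [add_right_comm]
    linarith
  have hvar : Summable fun k => ‖r (k + 1) - r k‖ := by
    refine Summable.of_nonneg_of_le (fun _ => norm_nonneg _) (fun k => ?_) (hD.add hε)
    have : r (k + 1) - r k = (P k *ᵥ r k - r k) + ε k := by rw [hr]; abel
    rw [this]
    refine (norm_add_le _ _).trans (add_le_add_left ?_ _)
    -- Each coordinate of `P r - r` is a weighted average of differences of coordinates of `r`.
    refine (pi_norm_le_iff_of_nonneg (spread_nonneg _)).2 fun i => ?_
    have h1 : (P k *ᵥ r k - r k) i = ∑ j, P k i j * (r k j - r k i) := by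
      simp only [mul_sub, Finset.sum_sub_distrib, ← Finset.sum_mul,
        sum_row_of_mem_rowStochastic (hP k), one_mul]
      rfl
    rw [h1]
    calc ‖∑ j, P k i j * (r k j - r k i)‖ ≤ ∑ j, P k i j * spread (r k) :=
          norm_sum_le_of_le _ fun j _ => by
            rw [norm_mul, Real.norm_of_nonneg ((hP k).1 i j)]
            exact mul_le_mul_of_nonneg_left (abs_sub_le_spread _ _ _) ((hP k).1 i j)
      _ = spread (r k) := by
          rw [← Finset.sum_mul, sum_row_of_mem_rowStochastic (hP k), one_mul]
  refine ⟨hvar, ?_⟩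
  obtain ⟨v, hv⟩ := cauchySeq_tendsto_of_complete <| cauchySeq_of_summable_dist (f := r) <| by
    simpa only [dist_eq_norm, norm_sub_rev] using hvar
  rw [tendsto_pi_nhds] at hv
  rcases isEmpty_or_nonempty ι with hι | ⟨⟨i₀⟩⟩
  · exact ⟨0, fun i => hι.elim i⟩
  refine ⟨v i₀, fun i => ?_⟩
  have hdiff : Tendsto (fun k => r k i - r k i₀) atTop (𝓝 0) :=
    squeeze_zero_norm (fun k => abs_sub_le_spread (r k) i i₀) hD.tendsto_atTop_zero
  simpa using hdiff.add (hv i₀)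

/-! ### The closed-loop companion matrix -/

lemma sysA_map_mulVec_castSucc {n : ℕ} {R : Type*} [CommRing R] [Algebra ℝ R] (v : Fin (n + 1) → R)
    (j : Fin n) : ((sysA n).map (algebraMap ℝ R) *ᵥ v) j.castSucc = v j.succ := by
  rw [mulVec, dotProduct, Finset.sum_eq_single j.succ]
  · simp [sysA]
  · intro l _ hl
    have : (l : ℕ) ≠ (j : ℕ) + 1 := fun h => hl (Fin.ext (by simpa using h))
    simp [sysA, this]
  · simp

lemma sysA_map_mulVec_last {n : ℕ} {R : Type*} [CommRing R] [Algebra ℝ R] (v : Fin (n + 1) → R) :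
    ((sysA n).map (algebraMap ℝ R) *ᵥ v) (Fin.last n) = 0 := by
  rw [mulVec, dotProduct]
  refine Finset.sum_eq_zero fun l _ => ?_
  have : (l : ℕ) ≠ n + 1 := by omega
  simp [sysA, this]

lemma gainK5_dotProduct_sysA_mulVec {n : ℕ} (b : Fin n → ℝ) (v : Fin (n + 1) → ℝ) :
    gainK5 b ⬝ᵥ (sysA n *ᵥ v) = Fin.cons (α := fun _ => ℝ) 0 b ⬝ᵥ v := by
  have h1 := sysA_map_mulVec_castSucc (R := ℝ) v
  have h2 := sysA_map_mulVec_last (R := ℝ) v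
  have hmap : (sysA n).map (algebraMap ℝ ℝ) = sysA n := by ext; simp
  rw [hmap] at h1 h2
  rw [dotProduct, dotProduct, Fin.sum_univ_castSucc, Fin.sum_univ_succ]
  simp [h1, h2, gainK5]

lemma gainK5_dotProduct_sysB {n : ℕ} (b : Fin n → ℝ) : gainK5 b ⬝ᵥ sysB n = 1 := by
  simp [gainK5, sysB]

/-- `A - B K₅ A`: the dynamics of one agent once `K₅ z` is regarded as an external input. -/
def companionMatrix {n : ℕ} (b : Fin n → ℝ) : Matrix (Fin (n + 1)) (Fin (n + 1)) ℝ :=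
  sysA n - vecMulVec (sysB n) (Fin.cons (α := fun _ => ℝ) 0 b)

/-- The shift rows force an eigenvector to be `v 0 • (1, μ, …, μ ^ n)` with `v 0 ≠ 0`; the last row
then says that `μ` times the polynomial of hypothesis 3 at `μ` vanishes. -/
lemma isSchur_companionMatrix {n : ℕ} {b : Fin n → ℝ} (hb : CharRootsInUnitDisc b) :
    IsSchur (companionMatrix b) := by
  intro μ hμ
  rw [← spectrum_toLin', ← Module.End.hasEigenvalue_iff_mem_spectrum] at hμ
  obtain ⟨v, hv⟩ := hμ.exists_hasEigenvector
  have hne := hv.2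
  have heq : (companionMatrix b).map (algebraMap ℝ ℂ) *ᵥ v = μ • v := by
    simpa using hv.apply_eq_smul
  have hmap : (companionMatrix b).map (algebraMap ℝ ℂ) = (sysA n).map (algebraMap ℝ ℂ) -
      vecMulVec (fun i => (algebraMap ℝ ℂ) (sysB n i))
        (fun i => (algebraMap ℝ ℂ) (Fin.cons (α := fun _ => ℝ) 0 b i)) := by
    ext i j
    simp [companionMatrix, vecMulVec_apply]
  have hcoord : ∀ i, ((sysA n).map (algebraMap ℝ ℂ) *ᵥ v) i -
      (sysB n i : ℂ) * ∑ j : Fin n, (b j : ℂ) * v j.succ = μ * v i := fun i => by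
    have := congrFun heq i
    rw [hmap, sub_mulVec, Pi.sub_apply] at this
    rw [Pi.smul_apply, smul_eq_mul] at this
    rw [← this]
    congr 1
    simp [mulVec, dotProduct, vecMulVec_apply, Fin.sum_univ_succ, Finset.mul_sum, mul_assoc]
  have hpow : ∀ m (h : m < n + 1), v ⟨m, h⟩ = μ ^ m * v 0 := by
    intro m
    induction m with
    | zero => intro h; simp
    | succ m ih =>
      intro h
      have hm : m < n := by omega
      have h1 := hcoord (Fin.castSucc ⟨m, hm⟩)
      rw [sysA_map_mulVec_castSucc] at h1
      have h2 : sysB n (Fin.castSucc ⟨m, hm⟩) = 0 := by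
        rw [sysB, Pi.single_eq_of_ne (Fin.castSucc_lt_last _).ne]
      rw [h2] at h1
      have h3 := ih (by omega)
      simp only [Fin.succ_mk, Fin.castSucc_mk, Complex.ofReal_zero, zero_mul, sub_zero] at h1
      rw [h1, h3, pow_succ']
      ring
  have hv0 : v 0 ≠ 0 := fun h0 => hne <| by
    ext ⟨m, hm⟩
    simp [hpow m hm, h0]
  have hlast := hcoord (Fin.last n)
  rw [sysA_map_mulVec_last, show v (Fin.last n) = μ ^ n * v 0 from hpow n (by omega)] at hlast
  have hsum : ∑ j : Fin n, (b j : ℂ) * v j.succ =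
      μ * (∑ j : Fin n, (b j : ℂ) * μ ^ (j : ℕ)) * v 0 := by
    rw [Finset.mul_sum, Finset.sum_mul]
    refine Finset.sum_congr rfl fun j _ => ?_
    rw [show v j.succ = μ ^ ((j : ℕ) + 1) * v 0 from hpow _ _]
    ring
  rw [hsum] at hlast
  simp only [sysB, Pi.single_eq_same, Complex.ofReal_one, one_mul, zero_sub] at hlast
  have hprod : μ * (μ ^ n + ∑ j : Fin n, (b j : ℂ) * μ ^ (j : ℕ)) * v 0 = 0 := by
    linear_combination -hlast
  rcases mul_eq_zero.1 ((mul_eq_zero.1 hprod).resolve_right hv0) with h | h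
  · simp [h]
  · exact hb μ h

/-! ### The averaging matrices of the protocol -/

namespace SwitchingTopology

variable {N : ℕ} {S : Type*} (T : SwitchingTopology N S)

/-- The row-stochastic matrix by which `K₅ z` is averaged in the graph with index `p`. -/
noncomputable def averagingMatrix (p : S) : Matrix (Fin N) (Fin N) ℝ :=
  Matrix.of fun i j =>
    ((if i = j then 1 else 0) + if j ∈ T.neighbors p i then T.weight p i j else 0) /
      (1 + ∑ l ∈ T.neighbors p i, T.weight p i l)

lemma mem_neighbors {p : S} {i j : Fin N} : j ∈ T.neighbors p i ↔ (T.graph p).Adj j i := by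
  simp [neighbors]

lemma one_add_sum_weight_pos (p : S) (i : Fin N) :
    0 < 1 + ∑ l ∈ T.neighbors p i, T.weight p i l := by
  have := Finset.sum_nonneg fun l (hl : l ∈ T.neighbors p i) =>
    (T.weight_pos p i l (T.mem_neighbors.1 hl)).le
  linarith

lemma neighborWeight_nonneg (p : S) (i j : Fin N) :
    0 ≤ if j ∈ T.neighbors p i then T.weight p i j else 0 := by
  split_ifs with h
  · exact (T.weight_pos p i j (T.mem_neighbors.1 h)).le
  · exact le_rfl

lemma averagingMatrix_mem_rowStochastic (p : S) :
    T.averagingMatrix p ∈ rowStochastic ℝ (Fin N) := by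
  rw [mem_rowStochastic_iff_sum]
  refine ⟨fun i j => div_nonneg (add_nonneg ?_ (T.neighborWeight_nonneg p i j))
    (T.one_add_sum_weight_pos p i).le, fun i => ?_⟩
  · split_ifs <;> norm_num
  · simp only [averagingMatrix, of_apply]
    rw [← Finset.sum_div, div_eq_one_iff_eq (T.one_add_sum_weight_pos p i).ne',
      Finset.sum_add_distrib]
    simp

lemma averagingMatrix_apply_self_pos (p : S) (i : Fin N) : 0 < T.averagingMatrix p i i := by
  have := T.neighborWeight_nonneg p i i
  refine div_pos ?_ (T.one_add_sum_weight_pos p i)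
  rw [if_pos rfl]
  linarith

lemma averagingMatrix_apply_pos {p : S} {i j : Fin N} (h : (T.graph p).Adj j i) :
    0 < T.averagingMatrix p i j := by
  refine div_pos ?_ (T.one_add_sum_weight_pos p i)
  rw [if_pos (T.mem_neighbors.2 h)]
  have := T.weight_pos p i j h
  split_ifs <;> linarith

lemma averagingMatrix_mulVec (p : S) (r : Fin N → ℝ) (i : Fin N) :
    (T.averagingMatrix p *ᵥ r) i = r i - (1 / (1 + ∑ j ∈ T.neighbors p i, T.weight p i j)) *
      ∑ j ∈ T.neighbors p i, T.weight p i j * (r i - r j) := by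
  have hpos := T.one_add_sum_weight_pos p i
  have h1 : (T.averagingMatrix p *ᵥ r) i = (r i + ∑ j ∈ T.neighbors p i, T.weight p i j * r j) /
      (1 + ∑ j ∈ T.neighbors p i, T.weight p i j) := by
    simp only [mulVec, dotProduct, averagingMatrix, of_apply, div_mul_eq_mul_div]
    rw [← Finset.sum_div]
    simp [add_mul, Finset.sum_add_distrib]
  rw [h1]
  simp only [mul_sub, Finset.sum_sub_distrib, ← Finset.sum_mul]
  field_simp
  ring

end SwitchingTopology

lemma exists_pos_forall_le_of_pos {α : Type*} [Finite α] (f : α → ℝ) :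
    ∃ η : ℝ, 0 < η ∧ ∀ a, 0 < f a → η ≤ f a := by
  classical
  rcases isEmpty_or_nonempty α with hα | hα
  · exact ⟨1, one_pos, fun a => hα.elim a⟩
  -- The default 1 keeps the minimum positive when some values of `f` are not.
  obtain ⟨a, ha⟩ := Finite.exists_min fun a => if 0 < f a then f a else 1
  refine ⟨if 0 < f a then f a else 1, by split_ifs with h <;> [exact h; exact one_pos],
    fun x hx => (ha x).trans_eq (if_pos hx)⟩

/-! ### The closed loop -/

namespace IsTrajectory

variable {N n : ℕ} {S : Type*} {T : SwitchingTopology N S} {σ : ℕ → S}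
  {b : Fin n → ℝ} {C K6 : Fin (n + 1) → ℝ} {x z : Fin N → ℕ → Fin (n + 1) → ℝ}
  {u y : Fin N → ℕ → ℝ}

lemma error_succ (h : IsTrajectory T σ b C K6 x z u y) (i : Fin N) (k : ℕ) :
    z i (k + 1) - x i (k + 1) = observerMatrix K6 C *ᵥ (z i k - x i k) := by
  rw [h.state, h.observer, h.output, mulVec_sub]
  have : observerMatrix K6 C *ᵥ x i k = sysA n *ᵥ x i k + (C ⬝ᵥ x i k) • K6 := by
    rw [observerMatrix, add_mulVec, vecMulVec_mulVec]
    simp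
  rw [this]
  abel

lemma observer_eq (h : IsTrajectory T σ b C K6 x z u y) (i : Fin N) (k : ℕ) :
    z i (k + 1) = sysA n *ᵥ z i k + u i k • sysB n + (C ⬝ᵥ (z i k - x i k)) • K6 := by
  rw [h.observer, h.output, observerMatrix, add_mulVec, vecMulVec_mulVec, dotProduct_sub, sub_smul]
  simp only [op_smul_eq_smul]
  abel

lemma gainK5_dotProduct_observer (h : IsTrajectory T σ b C K6 x z u y) (i : Fin N) (k : ℕ) :
    gainK5 b ⬝ᵥ z i (k + 1) = Fin.cons (α := fun _ => ℝ) 0 b ⬝ᵥ z i k + u i k +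
      (C ⬝ᵥ (z i k - x i k)) * (gainK5 b ⬝ᵥ K6) := by
  rw [h.observer_eq, dotProduct_add, dotProduct_add, gainK5_dotProduct_sysA_mulVec,
    dotProduct_smul, dotProduct_smul, gainK5_dotProduct_sysB]
  simp

/-- The `-K₅ A z_i` part of `K₄ z_i` cancels the drift `K₅ A z_i`, leaving `K₅ z_i` minus the
weighted neighbor differences. -/
lemma gainK5_dotProduct_succ (h : IsTrajectory T σ b C K6 x z u y) (k : ℕ) :
    (fun i => gainK5 b ⬝ᵥ z i (k + 1)) =
      T.averagingMatrix (σ k) *ᵥ (fun i => gainK5 b ⬝ᵥ z i k) +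
        fun i => (C ⬝ᵥ (z i k - x i k)) * (gainK5 b ⬝ᵥ K6) := by
  ext i
  have hK4 : gainK4 b = gainK5 b - Fin.cons (α := fun _ => ℝ) 0 b := rfl
  rw [h.gainK5_dotProduct_observer, Pi.add_apply, T.averagingMatrix_mulVec, h.input, hK4,
    sub_dotProduct]
  simp only [dotProduct_sub]
  ring

/-- The input `u_i` is eliminated by means of `K₅ z_i[k+1]`, whose convergence and bounded variation
are known from the averaging process. -/
lemma observer_succ_eq_companionMatrix (h : IsTrajectory T σ b C K6 x z u y) (i : Fin N) (k : ℕ) :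
    z i (k + 1) = companionMatrix b *ᵥ z i k + ((gainK5 b ⬝ᵥ z i (k + 1)) • sysB n +
      (C ⬝ᵥ (z i k - x i k)) • (K6 - (gainK5 b ⬝ᵥ K6) • sysB n)) := by
  rw [h.gainK5_dotProduct_observer, companionMatrix, sub_mulVec, vecMulVec_mulVec]
  conv_lhs => rw [h.observer_eq]
  ext l
  simp
  ring

lemma summable_norm_error (h : IsTrajectory T σ b C K6 x z u y)
    (hSchur : IsSchur (observerMatrix K6 C)) (i : Fin N) :
    Summable fun k => ‖z i k - x i k‖ :=
  hSchur.summable_norm (h := fun _ => 0) (fun k => by rw [h.error_succ, add_zero]) (by simp)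

lemma summable_abs_outputError (h : IsTrajectory T σ b C K6 x z u y)
    (hSchur : IsSchur (observerMatrix K6 C)) (i : Fin N) :
    Summable fun k => |C ⬝ᵥ (z i k - x i k)| := by
  refine Summable.of_nonneg_of_le (fun _ => abs_nonneg _) (fun k => ?_)
    ((h.summable_norm_error hSchur i).mul_left (∑ l, |C l|))
  rw [Finset.sum_mul]
  refine (Finset.abs_sum_le_sum_abs _ _).trans (Finset.sum_le_sum fun l _ => ?_)
  rw [abs_mul]
  exact mul_le_mul_of_nonneg_left (norm_le_pi_norm (z i k - x i k) l) (abs_nonneg _)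

lemma summable_norm_gainK5_perturbation (h : IsTrajectory T σ b C K6 x z u y)
    (hSchur : IsSchur (observerMatrix K6 C)) :
    Summable fun k => ‖fun i => (C ⬝ᵥ (z i k - x i k)) * (gainK5 b ⬝ᵥ K6)‖ := by
  refine Summable.of_nonneg_of_le (fun _ => norm_nonneg _) (fun k => ?_)
    (summable_sum fun i (_ : i ∈ Finset.univ) =>
      (h.summable_abs_outputError hSchur i).mul_right |gainK5 b ⬝ᵥ K6|)
  refine (pi_norm_le_iff_of_nonneg (Finset.sum_nonneg fun i _ => by positivity)).2 fun i => ?_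
  rw [Real.norm_eq_abs, abs_mul]
  exact Finset.single_le_sum (f := fun i => |C ⬝ᵥ (z i k - x i k)| * |gainK5 b ⬝ᵥ K6|)
    (fun i _ => by positivity) (Finset.mem_univ i)

end IsTrajectory

end HighOrderConsensus

theorem theorem3 {N n : ℕ} {S : Type*} [Finite S]
    (T : HighOrderConsensus.SwitchingTopology N S) (σ : ℕ → S)
    (b : Fin n → ℝ) (C K6 : Fin (n + 1) → ℝ)
    (hconn : HighOrderConsensus.UniformlyJointlyQSC fun k => T.graph (σ k))
    (hSchur : HighOrderConsensus.IsSchur (HighOrderConsensus.observerMatrix K6 C))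
    (hroots : HighOrderConsensus.CharRootsInUnitDisc b)
    (x z : Fin N → ℕ → Fin (n + 1) → ℝ) (u y : Fin N → ℕ → ℝ)
    (htraj : HighOrderConsensus.IsTrajectory T σ b C K6 x z u y) :
    HighOrderConsensus.ReachesConsensus x := by
  open HighOrderConsensus in
  obtain ⟨η, hη, hle⟩ := exists_pos_forall_le_of_pos
    fun a : S × Fin N × Fin N => T.averagingMatrix a.1 a.2.1 a.2.2
  obtain ⟨hvar, c, hc⟩ := exists_consensus_of_summable_perturbation
    (P := fun k => T.averagingMatrix (σ k)) (fun k => T.averagingMatrix_mem_rowStochastic _)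
    (fun k i => T.averagingMatrix_apply_self_pos _ i) hη (fun k i j => hle (σ k, i, j))
    (G := fun k => T.graph (σ k)) (fun k i j h => T.averagingMatrix_apply_pos h) hconn
    (r := fun k i => gainK5 b ⬝ᵥ z i k) htraj.gainK5_dotProduct_succ
    (htraj.summable_norm_gainK5_perturbation hSchur)
  have hF := isSchur_companionMatrix hroots
  have hlim : ∀ i, ∃ v, Tendsto (z i) atTop (𝓝 v) ∧ v = companionMatrix b *ᵥ v + c • sysB n := by
    intro i
    have he := htraj.summable_abs_outputError hSchur i
    refine hF.exists_tendsto (htraj.observer_succ_eq_companionMatrix i) ?_ ?_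
    · have h1 : Summable fun k => |gainK5 b ⬝ᵥ z i (k + 1 + 1) - gainK5 b ⬝ᵥ z i (k + 1)| :=
        Summable.of_nonneg_of_le (fun _ => abs_nonneg _)
          (fun k => norm_le_pi_norm
            ((fun i => gainK5 b ⬝ᵥ z i (k + 1 + 1)) - fun i => gainK5 b ⬝ᵥ z i (k + 1)) i)
          ((summable_nat_add_iff 1).2 hvar)
      have h2 := ((summable_nat_add_iff 1).2 he).add he
      refine Summable.of_nonneg_of_le (fun _ => norm_nonneg _) (fun k => ?_)
        ((h1.mul_right ‖sysB n‖).add (h2.mul_right ‖K6 - (gainK5 b ⬝ᵥ K6) • sysB n‖))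
      rw [add_sub_add_comm, ← sub_smul, ← sub_smul]
      refine (norm_add_le _ _).trans ?_
      rw [norm_smul, norm_smul, Real.norm_eq_abs, Real.norm_eq_abs]
      gcongr
      exact abs_sub _ _
    · have h1 := ((tendsto_add_atTop_iff_nat 1).2 (hc i)).smul_const (sysB n)
      have h2 := (tendsto_zero_iff_abs_tendsto_zero _).2 he.tendsto_atTop_zero
      simpa using h1.add (h2.smul_const (K6 - (gainK5 b ⬝ᵥ K6) • sysB n))
  choose v hv hfix using hlim
  -- The constant term is the same for all agents, so a difference of limits is fixed by a Schur
  -- matrix and vanishes.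
  have huniq : ∀ i j, v i = v j := fun i j => by
    refine sub_eq_zero.1 (hF.eq_zero_of_mulVec_eq_self ?_)
    nth_rewrite 2 [hfix i, hfix j]
    rw [mulVec_sub]
    abel
  have hx : ∀ i, Tendsto (x i) atTop (𝓝 (v i)) := fun i => by
    have h0 := tendsto_zero_iff_norm_tendsto_zero.2
      (htraj.summable_norm_error hSchur i).tendsto_atTop_zero
    simpa using (hv i).sub h0
  rcases isEmpty_or_nonempty (Fin N) with hN | ⟨⟨i₀⟩⟩
  · exact ⟨0, fun i => hN.elim i⟩
  · exact ⟨v i₀, fun i => huniq i i₀ ▸ hx i⟩
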